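/- Let $K$ be a compact Hausdorff space and let $C(K)$ be the Banach space of continuous real-valued functions on $K$ with the supremum norm $\|\cdot\|_\infty$. Suppose that $C(K)$ admits an equivalent norm whose dual norm on $C(K)^*$ is locally uniformly rotund. (A norm $q$ is locally uniformly rotund if $q(x)=q(x_n)=1$ for all $n$ and $q(x+x_n)\to2$ imply $q(x-x_n)\to0$.) Then $C(K)$ admits an equivalent norm that is of class $C^\infty$ on $C(K)\setminus\{0\}$. Such norms can be found arbitrarily close to the supremum norm and of the following form. The space $K$ is $\sigma$-discrete: there are pairwise disjoint sets $D_0,D_1,\dots$ with union $K$, each discrete in its subspace topology. These sets can be chosen so that for every $\varepsilon>0$ there are real numbers $r_i\in(0,1)$, $i\in\mathbb N$, with $a:=\prod_i r_i>0$ and $a^{-1}\le1+\varepsilon$, and, for each $t\in K$, an Orlicz function $\phi_t:[0,\infty)\to[0,\infty)$ (convex, $\phi_t(0)=0$, $\lim_{x\to\infty}\phi_t(x)=\infty$) of class $C^\infty$ with $$\phi_t(x)=0\ \text{ for } 0\le x\le\prod\{r_i:t\in\overline{D_i}\},\qquad \phi_t(x)>1\ \text{ for } x\ge\prod\{r_i:t\in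 D_i'\},$$ where $D_i'$ is the set of accumulation points of $D_i$ and an empty product is $1$, such that the generalized Orlicz norm $$\|f\|_{\phi}=\inf\Bigl\{\rho>0:\sum_{t\in K}\phi_t(|f(t)|/\rho)\le1\Bigr\}$$ is an equivalent norm on $C(K)$, is of class $C^\infty$ on $C(K)\setminus\{0\}$, and satisfies $\|f\|_\infty\le\|f\|_\phi\le a^{-1}\|f\|_\infty\le(1+\varepsilon)\|f\|_\infty$ for all $f\in C(K)$. -/

import Mathlib

open Set Filter Topology
open scoped ContDiff ENNReal

noncomputable section

/-- `p` is an equivalent norm on the normed space `E`. -/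
def IsEquivalentNorm {E : Type*} [NormedAddCommGroup E] [NormedSpace ℝ E]
    (p : Seminorm ℝ E) : Prop :=
  ∃ c C : ℝ, 0 < c ∧ 0 < C ∧ ∀ x : E, c * ‖x‖ ≤ p x ∧ p x ≤ C * ‖x‖

/-- The norm on the topological dual of `E` that is dual to `p`:
the supremum of `|x' x|` over the closed unit ball of `p`. -/
def dualNorm {E : Type*} [NormedAddCommGroup E] [NormedSpace ℝ E]
    (p : Seminorm ℝ E) (x' : StrongDual ℝ E) : ℝ :=
  sSup ((fun x : E => |x' x|) '' {x : E | p x ≤ 1})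

/-- Local uniform rotundity of a norm `q` on a vector space. -/
def IsLocallyUniformlyRotund {F : Type*} [AddCommGroup F] (q : F → ℝ) : Prop :=
  ∀ (x : F) (u : ℕ → F), q x = 1 → (∀ n, q (u n) = 1) →
    Tendsto (fun n => q (x + u n)) atTop (𝓝 2) →
    Tendsto (fun n => q (x - u n)) atTop (𝓝 0)

/-- `D 0, D 1, …` is a partition of `K` into countably many (possibly empty) sets, each of
which is discrete in its subspace topology; so it witnesses that `K` is σ-discrete. -/
structure IsDiscretePartition {K : Type*} [TopologicalSpace K] (D : ℕ → Set K) : Prop where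
  disjoint : ∀ i j : ℕ, i ≠ j → Disjoint (D i) (D j)
  iUnion_eq : ⋃ i, D i = univ
  discrete : ∀ i, DiscreteTopology (D i)

/-- The product of the `r i` over those `i` for which `t` is in the closure of `D i`. -/
def closureProd {K : Type*} [TopologicalSpace K] (D : ℕ → Set K) (r : ℕ → ℝ) (t : K) : ℝ :=
  ∏' i : {i : ℕ // t ∈ closure (D i)}, r i

/-- The product of the `r i` over those `i` for which `t` is an accumulation point of `D i`. -/
def derivedProd {K : Type*} [TopologicalSpace K] (D : ℕ → Set K) (r : ℕ → ℝ) (t : K) : ℝ :=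
  ∏' i : {i : ℕ // t ∈ derivedSet (D i)}, r i

/-- Orlicz functions `[0, ∞) → [0, ∞)`; the values at negative reals play no role. -/
structure IsOrliczFunction (φ : ℝ → ℝ) : Prop where
  convexOn : ConvexOn ℝ (Ici 0) φ
  nonneg : ∀ x, 0 ≤ x → 0 ≤ φ x
  map_zero : φ 0 = 0
  tendsto_atTop : Tendsto φ atTop atTop

/-- The generalized Orlicz norm `inf {ρ > 0 : ∑ₜ φₜ(|f t| / ρ) ≤ 1}`. -/
def orliczNorm {K : Type*} (φ : K → ℝ → ℝ) (f : K → ℝ) : ℝ :=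
  sInf {ρ : ℝ | 0 < ρ ∧ ∑' t, ENNReal.ofReal (φ t (|f t| / ρ)) ≤ 1}

end

/-!
Two ideas carry the proof.

*Rotundity makes `K` σ-discrete.* Let `q` be the locally uniformly rotund dual norm and
`w t = q (δ t)`. A function `x` in the predual unit ball that almost attains the norm of `δ t` cuts
out a weak-star open slice of the dual ball around `δ t / w t`; by rotundity thin slices have small
diameter, while the evaluations at distinct points of `K` are uniformly apart. Hence, for a
rational `l` just above `w t`, no other point `s` near `t` has `w s ≤ l`
(`exists_rat_forall_mem_nhds_eq`). So `K` is the union over rational `l` of the sets of isolated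
points of `{w ≤ l}`, which are discrete.

*The Orlicz modular depends locally on finitely many coordinates.* Take `r i = exp (-c i)` with
`∑ c i = log (1 + ε)`. Discreteness of the pieces gives `closureProd < derivedProd` at every point
(`closureProd_lt_derivedProd`), so flat smooth convex `φ t` fit between these two thresholds. At
each `t` the lower limit of `closureProd` along `s → t`, `s ≠ t`, is at least `derivedProd t`
(`eventually_lt_closureProd`). A function `g` in the Orlicz unit ball satisfies
`|g t| < derivedProd t` everywhere, and a compactness argument shows that near `g` only finitely
many `φ t` fail to vanish (`IsSmoothOrliczFamily.exists_finset_eventually_eq_zero`). The unit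
sphere is therefore locally the level set `m = 1` of a smooth convex function `m` with `m 0 = 0`;
convexity makes its radial derivative at least `1` there, and the implicit function theorem gives
smoothness of the norm (`Seminorm.contDiffAt_of_convexOn`).
-/

noncomputable section

/-! ### Flat smooth Orlicz functions -/

/-- The antiderivative of the flat function `exp (-1 / x)` that vanishes at `0`: a smooth convex
function which is zero exactly on `(-∞, 0]`. -/
def flatConvex (x : ℝ) : ℝ := ∫ u in (0 : ℝ)..x, expNegInvGlue u

theorem hasDerivAt_flatConvex (x : ℝ) : HasDerivAt flatConvex (expNegInvGlue x) x :=
  ((expNegInvGlue.contDiff (n := 0)).continuous.integral_hasStrictDerivAt 0 x).hasDerivAt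

theorem deriv_flatConvex : deriv flatConvex = expNegInvGlue :=
  funext fun x => (hasDerivAt_flatConvex x).deriv

theorem differentiable_flatConvex : Differentiable ℝ flatConvex :=
  fun x => (hasDerivAt_flatConvex x).differentiableAt

theorem contDiff_flatConvex : ContDiff ℝ ∞ flatConvex := by
  rw [contDiff_infty_iff_deriv, deriv_flatConvex]
  exact ⟨differentiable_flatConvex, expNegInvGlue.contDiff⟩

theorem monotone_flatConvex : Monotone flatConvex := by
  refine monotone_of_deriv_nonneg differentiable_flatConvex fun x => ?_
  rw [deriv_flatConvex]
  exact expNegInvGlue.nonneg x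

theorem convexOn_flatConvex : ConvexOn ℝ univ flatConvex := by
  refine Monotone.convexOn_univ_of_deriv differentiable_flatConvex ?_
  rw [deriv_flatConvex]
  exact expNegInvGlue.monotone

theorem flatConvex_of_nonpos {x : ℝ} (hx : x ≤ 0) : flatConvex x = 0 := by
  rw [flatConvex, intervalIntegral.integral_congr (g := fun _ => (0 : ℝ))]
  · simp
  · intro u hu
    rw [uIcc_of_ge hx] at hu
    exact expNegInvGlue.zero_of_nonpos hu.2

theorem flatConvex_pos {x : ℝ} (hx : 0 < x) : 0 < flatConvex x :=
  intervalIntegral.intervalIntegral_pos_of_pos_on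
    ((expNegInvGlue.contDiff (n := 0)).continuous.intervalIntegrable 0 x)
    (fun _ hu => expNegInvGlue.pos_of_pos hu.1) hx

theorem tendsto_flatConvex_atTop : Tendsto flatConvex atTop atTop := by
  have h1 : 0 < flatConvex 1 := flatConvex_pos one_pos
  refine tendsto_atTop_mono' atTop ?_ (tendsto_id.atTop_mul_const h1)
  filter_upwards [eventually_ge_atTop 1] with x hx
  have hx0 : 0 < x := one_pos.trans_le hx
  have h := convexOn_flatConvex.2 (mem_univ x) (mem_univ 0) (inv_nonneg.2 hx0.le)
    (sub_nonneg.2 (inv_le_one_of_one_le₀ hx)) (add_sub_cancel _ _)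
  simp only [smul_eq_mul, inv_mul_cancel₀ hx0.ne', mul_zero, add_zero,
    flatConvex_of_nonpos le_rfl] at h
  calc x * flatConvex 1 ≤ x * (x⁻¹ * flatConvex x) := by gcongr
    _ = flatConvex x := by rw [mul_inv_cancel_left₀ hx0.ne']

/-- For `a < b` there is a smooth convex monotone function on the line that vanishes up to `a` and
exceeds `1` from `b` on. -/
theorem exists_smooth_convex_between {a b : ℝ} (hab : a < b) :
    ∃ φ : ℝ → ℝ, ContDiff ℝ ∞ φ ∧ ConvexOn ℝ univ φ ∧ Monotone φ ∧ Tendsto φ atTop atTop ∧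
      (∀ x ≤ a, φ x = 0) ∧ ∀ x, b ≤ x → 1 < φ x := by
  have hpos : 0 < flatConvex (b - a) := flatConvex_pos (sub_pos.2 hab)
  have hc : 0 < 2 / flatConvex (b - a) := by positivity
  refine ⟨fun x => 2 / flatConvex (b - a) * flatConvex (x - a), ?_, ?_, ?_, ?_, ?_, ?_⟩
  · exact contDiff_const.mul (contDiff_flatConvex.comp (contDiff_id.sub contDiff_const))
  · have h := (convexOn_flatConvex.translate_left (-a)).smul hc.le
    simpa [Function.comp_def, ← sub_eq_add_neg] using h
  · intro x y hxy
    exact mul_le_mul_of_nonneg_left (monotone_flatConvex (sub_le_sub_right hxy a)) hc.le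
  · refine Tendsto.const_mul_atTop hc (tendsto_flatConvex_atTop.comp ?_)
    exact tendsto_atTop_add_const_right _ (-a) tendsto_id
  · intro x hx
    simp [flatConvex_of_nonpos (sub_nonpos.2 hx)]
  · intro x hx
    calc (1 : ℝ) < 2 / flatConvex (b - a) * flatConvex (b - a) := by
          rw [div_mul_cancel₀ _ hpos.ne']; norm_num
      _ ≤ _ := mul_le_mul_of_nonneg_left (monotone_flatConvex (sub_le_sub_right hx a)) hc.le

/-! ### The dual norm -/

section DualNorm

variable {E : Type*} [NormedAddCommGroup E] [NormedSpace ℝ E] {p : Seminorm ℝ E}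

theorem IsEquivalentNorm.abs_apply_le_dualNorm (hp : IsEquivalentNorm p) (x' : StrongDual ℝ E)
    {x : E} (hx : p x ≤ 1) : |x' x| ≤ dualNorm p x' := by
  obtain ⟨c, C, hc, -, h⟩ := hp
  refine le_csSup ⟨‖x'‖ * (1 / c), ?_⟩ (mem_image_of_mem _ hx)
  rintro _ ⟨y, hy, rfl⟩
  have hy' : ‖y‖ ≤ 1 / c := by
    rw [le_div_iff₀' hc]
    exact (h y).1.trans hy
  exact (x'.le_opNorm y).trans (by gcongr)

theorem dualNorm_le {x' : StrongDual ℝ E} {M : ℝ} (h : ∀ x, p x ≤ 1 → |x' x| ≤ M) :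
    dualNorm p x' ≤ M :=
  csSup_le (Nonempty.image _ ⟨0, by simp⟩) (by rintro _ ⟨x, hx, rfl⟩; exact h x hx)

theorem dualNorm_smul_of_nonneg (x' : StrongDual ℝ E) {a : ℝ} (ha : 0 ≤ a) :
    dualNorm p (a • x') = a * dualNorm p x' := by
  rw [dualNorm, dualNorm, ← smul_eq_mul, ← Real.sSup_smul_of_nonneg ha, ← image_smul, image_image]
  simp [abs_mul, abs_of_nonneg ha]

theorem exists_lt_apply_of_lt_dualNorm {x' : StrongDual ℝ E} {M : ℝ} (h : M < dualNorm p x') :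
    ∃ x, p x ≤ 1 ∧ M < x' x := by
  obtain ⟨_, ⟨x, hx, rfl⟩, hM⟩ :=
    exists_lt_of_lt_csSup (Nonempty.image _ (⟨0, by simp⟩ : {x : E | p x ≤ 1}.Nonempty)) h
  rcases lt_abs.1 hM with h | h
  · exact ⟨x, hx, h⟩
  · exact ⟨-x, by simpa using hx, by simpa using h⟩

theorem IsEquivalentNorm.exists_abs_apply_le (hp : IsEquivalentNorm p) :
    ∃ C : ℝ, 0 < C ∧ ∀ (x' : StrongDual ℝ E) (x : E), ‖x‖ ≤ 1 → |x' x| ≤ C * dualNorm p x' := by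
  obtain ⟨C, hC, h⟩ : ∃ C : ℝ, 0 < C ∧ ∀ x, p x ≤ C * ‖x‖ := by
    obtain ⟨c, C, hc, hC, h⟩ := hp
    exact ⟨C, hC, fun x => (h x).2⟩
  refine ⟨C, hC, fun x' x hx => ?_⟩
  have hpx : p (C⁻¹ • x) ≤ 1 := by
    rw [map_smul_eq_mul, Real.norm_of_nonneg (inv_nonneg.2 hC.le), inv_mul_le_one₀ hC]
    exact (h x).trans (mul_le_of_le_one_right hC.le hx)
  have := hp.abs_apply_le_dualNorm x' hpx
  rwa [map_smul, smul_eq_mul, abs_mul, abs_of_pos (inv_pos.2 hC), inv_mul_le_iff₀ hC] at this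

end DualNorm

/-! ### σ-discreteness -/

section SigmaDiscrete

variable {K : Type*} [TopologicalSpace K] [CompactSpace K] [T2Space K]

/-- Local uniform rotundity of the dual norm at the point `δ t`: for some rational level `l`, the
point `t` is isolated among the points whose evaluation functional has dual norm at most `l`. -/
theorem exists_rat_forall_mem_nhds_eq {p : Seminorm ℝ C(K, ℝ)} (hp : IsEquivalentNorm p)
    (hq : IsLocallyUniformlyRotund (dualNorm p)) (t : K) :
    ∃ l : ℚ, dualNorm p (ContinuousMap.evalCLM ℝ t) ≤ l ∧ ∃ U ∈ 𝓝 t,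
      ∀ s ∈ U, dualNorm p (ContinuousMap.evalCLM ℝ s) ≤ l → s = t := by
  obtain ⟨C, hC, hCle⟩ := hp.exists_abs_apply_le
  set w : K → ℝ := fun s => dualNorm p (ContinuousMap.evalCLM ℝ s)
  have hwpos (s : K) : 0 < w s := by
    have := hCle (ContinuousMap.evalCLM ℝ s) 1
      ((ContinuousMap.norm_le _ zero_le_one).2 (by simp))
    simp only [ContinuousMap.evalCLM_apply, ContinuousMap.one_apply, abs_one] at this
    exact pos_of_mul_pos_right (one_pos.trans_le this) hC.le
  by_contra! H
  let d : ℕ → ℝ := fun n => 1 - 1 / ((n : ℝ) + 1)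
  have hd (n : ℕ) : d n < 1 := sub_lt_self _ (by positivity)
  have hd0 (n : ℕ) : 0 ≤ d n := by
    simp only [d, sub_nonneg]
    rw [div_le_one (by positivity)]
    simp
  have key (n : ℕ) : ∃ s, s ≠ t ∧ ∃ x : C(K, ℝ), p x ≤ 1 ∧ d n * w t ≤ x t ∧ d n * w s ≤ x s := by
    obtain ⟨x, hx, hxt⟩ := exists_lt_apply_of_lt_dualNorm
      (show d n * w t < dualNorm p (ContinuousMap.evalCLM ℝ t) from
        mul_lt_of_lt_one_left (hwpos t) (hd n))
    rw [ContinuousMap.evalCLM_apply] at hxt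
    -- a rational level just above `w t`
    obtain ⟨l, hl1, hl2⟩ : ∃ l : ℚ, w t < l ∧ d n * l < x t := by
      have hcont : Tendsto (fun l : ℝ => d n * l) (𝓝[>] (w t)) (𝓝 (d n * w t)) :=
        ((continuous_const.mul continuous_id).tendsto _).mono_left nhdsWithin_le_nhds
      have hev := (hcont.eventually (gt_mem_nhds hxt))
      obtain ⟨u, hu, hsub⟩ := mem_nhdsGT_iff_exists_Ioo_subset.1 hev
      obtain ⟨l, h1, h2⟩ := exists_rat_btwn (mem_Ioi.1 hu)
      exact ⟨l, h1, hsub ⟨h1, h2⟩⟩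
    obtain ⟨s, hs, hsl, hst⟩ := H l hl1.le {s | d n * l < x s}
      ((isOpen_lt continuous_const x.continuous).mem_nhds hl2)
    exact ⟨s, hst, x, hx, hxt.le,
      (mul_le_mul_of_nonneg_left hsl (hd0 n)).trans (le_of_lt hs)⟩
  choose s hst x hx hxt hxs using key
  let u : K → StrongDual ℝ C(K, ℝ) := fun s => (w s)⁻¹ • ContinuousMap.evalCLM ℝ s
  have hu (s : K) : dualNorm p (u s) = 1 := by
    rw [dualNorm_smul_of_nonneg _ (inv_nonneg.2 (hwpos s).le), inv_mul_cancel₀ (hwpos s).ne']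
  have hlim : Tendsto (fun n => dualNorm p (u t + u (s n))) atTop (𝓝 2) := by
    have hd_lim : Tendsto (fun n => d n + d n) atTop (𝓝 2) := by
      have : Tendsto d atTop (𝓝 (1 - 0)) :=
        tendsto_const_nhds.sub tendsto_one_div_add_atTop_nhds_zero_nat
      have := this.add this
      norm_num at this
      exact this
    refine tendsto_of_tendsto_of_tendsto_of_le_of_le hd_lim tendsto_const_nhds (fun n => ?_)
      fun n => dualNorm_le fun y hy => ?_
    · refine le_trans ?_ ((le_abs_self _).trans (hp.abs_apply_le_dualNorm _ (hx n)))
      simp only [u, add_apply, smul_apply,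
        ContinuousMap.evalCLM_apply, smul_eq_mul]
      refine add_le_add ?_ ?_
      · rw [le_inv_mul_iff₀ (hwpos t), mul_comm]; exact hxt n
      · rw [le_inv_mul_iff₀ (hwpos _), mul_comm]; exact hxs n
    · have h1 := hp.abs_apply_le_dualNorm (u t) hy
      have h2 := hp.abs_apply_le_dualNorm (u (s n)) hy
      rw [hu] at h1 h2
      calc |(u t + u (s n)) y| ≤ |u t y| + |u (s n) y| := abs_add_le _ _
        _ ≤ 2 := by linarith
  have h0 := hq (u t) (fun n => u (s n)) (hu t) (fun n => hu _) hlim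
  -- the evaluations at distinct points are uniformly apart
  have hfar (n : ℕ) : (w t)⁻¹ ≤ C * dualNorm p (u t - u (s n)) := by
    obtain ⟨f, hf0, hf1, hf⟩ := exists_continuous_zero_one_of_isClosed
      (isClosed_singleton (x := s n)) (isClosed_singleton (x := t))
      (disjoint_singleton.2 (hst n))
    have hf0 : f (s n) = 0 := hf0 rfl
    have hf1 : f t = 1 := hf1 rfl
    have := hCle (u t - u (s n)) f ((ContinuousMap.norm_le _ zero_le_one).2 fun y => by
      rw [Real.norm_of_nonneg (hf y).1]; exact (hf y).2)
    refine le_trans ?_ this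
    refine le_trans (le_of_eq ?_) (le_abs_self _)
    simp [u, hf0, hf1]
  have := ge_of_tendsto' (h0.const_mul C) hfar
  rw [mul_zero] at this
  exact absurd this (not_le.2 (inv_pos.2 (hwpos t)))

/-- A compact space `K` such that `C(K)` has an equivalent norm with locally uniformly rotund dual
is σ-discrete: the pieces are the sets of isolated points of the sublevel sets of the function
`t ↦ ‖δ t‖`, at rational levels, made disjoint. -/
theorem exists_isDiscretePartition {p : Seminorm ℝ C(K, ℝ)} (hp : IsEquivalentNorm p)
    (hq : IsLocallyUniformlyRotund (dualNorm p)) : ∃ D : ℕ → Set K, IsDiscretePartition D := by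
  obtain ⟨e, he⟩ := exists_surjective_nat ℚ
  set w : K → ℝ := fun s => dualNorm p (ContinuousMap.evalCLM ℝ s)
  let S : ℕ → Set K := fun n => {t | w t ≤ e n ∧ ∃ U ∈ 𝓝 t, ∀ s ∈ U, w s ≤ e n → s = t}
  have hS (n : ℕ) : DiscreteTopology (S n) := by
    rw [discreteTopology_subtype_iff]
    rintro t ⟨-, U, hU, hUt⟩
    rw [← disjoint_iff, nhdsWithin, disjoint_principal_right, mem_inf_principal]
    filter_upwards [hU] with s hs hst hsS
    exact hst (hUt s hs hsS.1)
  refine ⟨disjointed S, fun i j hij => disjoint_disjointed S hij, ?_,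
    fun i => (hS i).of_subset (disjointed_subset S i)⟩
  rw [iUnion_disjointed, eq_univ_iff_forall]
  intro t
  obtain ⟨l, hl, h⟩ := exists_rat_forall_mem_nhds_eq hp hq t
  obtain ⟨n, rfl⟩ := he l
  exact mem_iUnion.2 ⟨n, hl, h⟩

end SigmaDiscrete

/-! ### Products of exponential weights -/

section Weights

variable {c : ℕ → ℝ}

theorem tprod_subtype_exp_neg (hc : Summable c) (A : Set ℕ) :
    ∏' i : A, Real.exp (-c i) = Real.exp (-∑' i : A, c i) := by
  rw [← Real.rexp_tsum_eq_tprod (fun _ => Real.exp_pos _)]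
  · simp only [Real.log_exp, tsum_neg]
  · simp only [Real.log_exp]
    exact (hc.subtype A).neg

theorem tsum_subtype_le_add (hc : Summable c) (h0 : ∀ i, 0 < c i) {A B C : Set ℕ}
    (h : A ⊆ B ∪ C) : ∑' i : A, c i ≤ ∑' i : B, c i + ∑' i : C, c i := by
  rw [tsum_subtype, tsum_subtype, tsum_subtype,
    ← (hc.indicator B).tsum_add (hc.indicator C)]
  refine (hc.indicator A).tsum_le_tsum (fun i => ?_) ((hc.indicator B).add (hc.indicator C))
  have hB : 0 ≤ B.indicator c i := indicator_nonneg (fun j _ => (h0 j).le) i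
  have hC : 0 ≤ C.indicator c i := indicator_nonneg (fun j _ => (h0 j).le) i
  by_cases hi : i ∈ A
  · rw [indicator_of_mem hi]
    rcases h hi with h | h
    · rw [indicator_of_mem h]; linarith
    · rw [indicator_of_mem h]; linarith
  · rw [indicator_of_notMem hi]; linarith

theorem tsum_subtype_lt (hc : Summable c) (h0 : ∀ i, 0 < c i) {A B : Set ℕ} (h : A ⊆ B) {j : ℕ}
    (hj : j ∈ B) (hjA : j ∉ A) : ∑' i : A, c i < ∑' i : B, c i := by
  rw [tsum_subtype, tsum_subtype]
  refine Summable.tsum_lt_tsum (i := j)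
    (indicator_le_indicator_of_subset h fun i => (h0 i).le) ?_ (hc.indicator A) (hc.indicator B)
  rw [indicator_of_mem hj, indicator_of_notMem hjA]
  exact h0 j

variable {K : Type*} [TopologicalSpace K] {D : ℕ → Set K}

theorem closureProd_exp_neg (hc : Summable c) (D : ℕ → Set K) (t : K) :
    closureProd D (fun i => Real.exp (-c i)) t =
      Real.exp (-∑' i : {i | t ∈ closure (D i)}, c i) :=
  tprod_subtype_exp_neg hc {i | t ∈ closure (D i)}

theorem derivedProd_exp_neg (hc : Summable c) (D : ℕ → Set K) (t : K) :
    derivedProd D (fun i => Real.exp (-c i)) t =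
      Real.exp (-∑' i : {i | t ∈ derivedSet (D i)}, c i) :=
  tprod_subtype_exp_neg hc {i | t ∈ derivedSet (D i)}

theorem exp_neg_tsum_le_closureProd (hc : Summable c) (h0 : ∀ i, 0 < c i) (D : ℕ → Set K) (t : K) :
    Real.exp (-∑' i, c i) ≤ closureProd D (fun i => Real.exp (-c i)) t := by
  rw [closureProd_exp_neg hc, Real.exp_le_exp, neg_le_neg_iff]
  exact hc.tsum_subtype_le _ _ (fun i => (h0 i).le)

theorem derivedProd_exp_neg_le_one (hc : Summable c) (h0 : ∀ i, 0 < c i) (D : ℕ → Set K) (t : K) :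
    derivedProd D (fun i => Real.exp (-c i)) t ≤ 1 := by
  rw [derivedProd_exp_neg hc, Real.exp_le_one_iff, neg_nonpos]
  exact tsum_nonneg fun i => (h0 i).le

/-- The index of the piece containing `t` contributes to `closureProd` but not to `derivedProd`,
because that piece is discrete. -/
theorem closureProd_lt_derivedProd (hD : IsDiscretePartition D) (hc : Summable c)
    (h0 : ∀ i, 0 < c i) (t : K) :
    closureProd D (fun i => Real.exp (-c i)) t < derivedProd D (fun i => Real.exp (-c i)) t := by
  obtain ⟨j, hj⟩ : ∃ j, t ∈ D j := mem_iUnion.1 (hD.iUnion_eq ▸ mem_univ t)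
  rw [closureProd_exp_neg hc, derivedProd_exp_neg hc, Real.exp_lt_exp, neg_lt_neg_iff]
  refine tsum_subtype_lt hc h0 (fun i hi => derivedSet_subset_closure _ hi)
    (subset_closure hj : t ∈ closure (D j)) fun h => ?_
  have := discreteTopology_subtype_iff.1 (hD.discrete j) t hj
  exact (mem_derivedSet.1 h).ne this

/-- The semicontinuity that makes the norm depend locally on finitely many coordinates: as `s → t`
with `s ≠ t`, only indices `i` with `t ∈ derivedSet (D i)` and indices of arbitrarily small total
weight can contribute to `closureProd D r s`. -/
theorem eventually_lt_closureProd [T1Space K] (hc : Summable c) (h0 : ∀ i, 0 < c i) {t : K} {y : ℝ}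
    (hy : y < derivedProd D (fun i => Real.exp (-c i)) t) :
    ∀ᶠ s in 𝓝[≠] t, y < closureProd D (fun i => Real.exp (-c i)) s := by
  rw [derivedProd_exp_neg hc] at hy
  set σ := ∑' i : {i | t ∈ derivedSet (D i)}, c i
  obtain ⟨F, hF⟩ : ∃ F : Finset ℕ, y < Real.exp (-(σ + ∑' i : {i // i ∉ F}, c i)) := by
    have h1 : Tendsto (fun F : Finset ℕ => Real.exp (-(σ + ∑' i : {i // i ∉ F}, c i))) atTop
        (𝓝 (Real.exp (-(σ + 0)))) :=
      ((tendsto_tsum_compl_atTop_zero c).const_add σ).neg.rexp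
    rw [add_zero] at h1
    exact (h1.eventually (lt_mem_nhds hy)).exists
  have hev : ∀ᶠ s in 𝓝[≠] t, ∀ i ∈ F, s ∈ closure (D i) → t ∈ derivedSet (D i) := by
    rw [Filter.eventually_all_finset]
    intro i _
    by_cases ht : t ∈ derivedSet (D i)
    · exact Eventually.of_forall fun _ _ => ht
    · have ht' := ht
      rw [← derivedSet_closure, mem_derivedSet, accPt_iff_frequently_nhdsNE, not_frequently] at ht'
      exact ht'.mono fun s hs h => absurd h hs
  filter_upwards [hev] with s hs
  refine hF.trans_le ?_
  rw [closureProd_exp_neg hc, Real.exp_le_exp, neg_le_neg_iff]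
  refine tsum_subtype_le_add hc h0 (C := {i | i ∉ F}) fun i hi => ?_
  by_cases hiF : i ∈ F
  · exact Or.inl (hs i hiF hi)
  · exact Or.inr hiF

end Weights

/-! ### Smoothness of a norm from a smooth convex equation of its unit sphere -/

/-- If near `g` a norm takes the value `1` wherever the smooth convex function `m` does, where
`m 0 = 0` and `m g = 1`, then the norm is smooth at `g`: solve `m (s • f) = 1` for `s`. -/
theorem Seminorm.contDiffAt_of_convexOn {E : Type*} [NormedAddCommGroup E] [NormedSpace ℝ E]
    [CompleteSpace E] (N : Seminorm ℝ E) {m : E → ℝ} (hm : ContDiff ℝ ∞ m)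
    (hconv : ConvexOn ℝ univ m) (h0 : m 0 = 0) {g : E} (hg : m g = 1)
    (hN : ∀ᶠ f in 𝓝 g, m f = 1 → N f = 1) : ContDiffAt ℝ ∞ N g := by
  let G : E × ℝ → ℝ := fun u => m (u.2 • u.1)
  have hG : ContDiffAt ℝ ∞ G (g, 1) := (hm.comp (contDiff_snd.smul contDiff_fst)).contDiffAt
  have htop : (∞ : WithTop ℕ∞) ≠ 0 := by simp
  set L := fderiv ℝ G (g, 1) ∘L ContinuousLinearMap.inr ℝ E ℝ
  have hderiv : HasDerivAt (fun s : ℝ => m (s • g)) (L 1) 1 :=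
    (hG.differentiableAt htop).hasFDerivAt.comp_hasDerivAt (1 : ℝ)
      ((hasDerivAt_const (1 : ℝ) g).prodMk (hasDerivAt_id (1 : ℝ)))
  -- by convexity the slope at `1` along the ray through `g` is at least `m g - m 0 = 1`
  have hL1 : 1 ≤ L 1 := by
    have hray : ConvexOn ℝ univ (fun s : ℝ => m (s • g)) :=
      hconv.comp_linearMap (LinearMap.toSpanSingleton ℝ E g)
    have := hray.slope_le_of_hasDerivAt (mem_univ 0) (mem_univ 1) one_pos hderiv
    simpa [slope_def_field, h0, hg] using this
  have hinv : L.IsInvertible := by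
    refine ⟨ContinuousLinearEquiv.unitsEquivAut ℝ (Units.mk0 (L 1) (by linarith)), ?_⟩
    ext
    simp
  let σ := hG.implicitFunction htop hinv
  have hσ : ContDiffAt ℝ ∞ σ g := hG.contDiffAt_implicitFunction htop hinv
  have hσ1 : σ g = 1 := hG.implicitFunction_apply_self htop hinv
  have hlevel : ∀ᶠ f in 𝓝 g, m (σ f • f) = 1 := by
    filter_upwards [hG.eventually_apply_implicitFunction htop hinv] with f hf
    simpa [G, hg] using hf
  have hlim : Tendsto (fun f => σ f • f) (𝓝 g) (𝓝 g) := by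
    have := hσ.continuousAt.tendsto.smul (tendsto_id (α := E) (x := 𝓝 g))
    simpa [hσ1] using this
  have hpos : ∀ᶠ f in 𝓝 g, 0 < σ f :=
    hσ.continuousAt.eventually (lt_mem_nhds (by rw [hσ1]; exact one_pos))
  refine (hσ.inv (by rw [hσ1]; exact one_ne_zero)).congr_of_eventuallyEq ?_
  filter_upwards [hlevel, hlim.eventually hN, hpos] with f h1 h2 h3
  have := h2 h1
  rw [map_smul_eq_mul, Real.norm_of_nonneg h3.le] at this
  exact eq_inv_of_mul_eq_one_right this

theorem Seminorm.contDiffAt_of_smul {E : Type*} [NormedAddCommGroup E] [NormedSpace ℝ E]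
    (N : Seminorm ℝ E) {f : E} {a : ℝ} (ha : 0 < a) (h : ContDiffAt ℝ ∞ N (a • f)) :
    ContDiffAt ℝ ∞ N f := by
  have hN : (N : E → ℝ) = fun x => a⁻¹ * N (a • x) := by
    ext x
    rw [map_smul_eq_mul, Real.norm_of_nonneg ha.le, inv_mul_cancel_left₀ ha.ne']
  rw [hN]
  exact contDiffAt_const.mul (ContDiffAt.comp f h (contDiff_const_smul a).contDiffAt)

/-! ### Generalized Orlicz norms -/

/-- Smooth convex functions `φ t`, vanishing up to `a t` and exceeding `1` from `b t` on, where
the thresholds satisfy `0 < α ≤ a t` and `b t ≤ 1`, and `b t` is at most the lower limit of `a`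
at `t`. The functions are taken on the whole line, so that `x ↦ φ t |x|` is smooth as well. -/
structure IsSmoothOrliczFamily {K : Type*} [TopologicalSpace K] (α : ℝ) (a b : K → ℝ)
    (φ : K → ℝ → ℝ) : Prop where
  contDiff : ∀ t, ContDiff ℝ ∞ (φ t)
  convexOn : ∀ t, ConvexOn ℝ univ (φ t)
  monotone : ∀ t, Monotone (φ t)
  eq_zero : ∀ t, ∀ x ≤ a t, φ t x = 0
  one_lt : ∀ t x, b t ≤ x → 1 < φ t x
  pos : 0 < α
  le : ∀ t, α ≤ a t
  le_one : ∀ t, b t ≤ 1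
  eventually_lt : ∀ t, ∀ y < b t, ∀ᶠ s in 𝓝[≠] t, y < a s

section Orlicz

variable {K : Type*} [TopologicalSpace K] {α : ℝ} {a b : K → ℝ} {φ : K → ℝ → ℝ}

/-- The Orlicz modular of `f` restricted to the finite set `S` of coordinates. -/
def partialModular (φ : K → ℝ → ℝ) (S : Finset K) (f : C(K, ℝ)) : ℝ := ∑ t ∈ S, φ t |f t|

/-- The unit ball of the Orlicz norm, described through finite partial sums of the modular. -/
def orliczBall (φ : K → ℝ → ℝ) : Set C(K, ℝ) := {f | ∀ S, partialModular φ S f ≤ 1}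

namespace IsSmoothOrliczFamily

variable (h : IsSmoothOrliczFamily α a b φ)
include h

theorem eq_zero_of_le {x : ℝ} (hx : x ≤ α) (t : K) : φ t x = 0 :=
  h.eq_zero t x (hx.trans (h.le t))

theorem nonneg (t : K) (x : ℝ) : 0 ≤ φ t x := by
  rcases le_total x α with hx | hx
  · exact (h.eq_zero_of_le hx t).ge
  · exact (h.eq_zero_of_le le_rfl t).symm.le.trans (h.monotone t hx)

theorem apply_abs (t : K) (x : ℝ) : φ t |x| = φ t x + φ t (-x) := by
  rcases le_total 0 x with hx | hx
  · rw [abs_of_nonneg hx, h.eq_zero_of_le ((neg_nonpos.2 hx).trans h.pos.le), add_zero]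
  · rw [abs_of_nonpos hx, h.eq_zero_of_le (hx.trans h.pos.le), zero_add]

theorem convexOn_partialModular (S : Finset K) : ConvexOn ℝ univ (partialModular φ S) := by
  refine ⟨convex_univ, fun f _ g _ u v hu hv huv => ?_⟩
  simp only [partialModular, smul_eq_mul, Finset.mul_sum, ← Finset.sum_add_distrib]
  refine Finset.sum_le_sum fun t _ => ?_
  refine (h.monotone t ?_).trans ((h.convexOn t).2 (mem_univ |f t|) (mem_univ |g t|) hu hv huv)
  refine (abs_add_le _ _).trans (le_of_eq ?_)
  simp [abs_mul, abs_of_nonneg hu, abs_of_nonneg hv]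

theorem partialModular_zero (S : Finset K) : partialModular φ S 0 = 0 :=
  Finset.sum_eq_zero fun t _ => h.eq_zero_of_le (by simpa using h.pos.le) t

theorem mem_orliczBall_of_le_one {S : Finset K} {f : C(K, ℝ)} (hS : ∀ t ∉ S, φ t |f t| = 0)
    (hf : partialModular φ S f ≤ 1) : f ∈ orliczBall φ := by
  classical
  intro T
  calc ∑ t ∈ T, φ t |f t| ≤ ∑ t ∈ S ∪ T, φ t |f t| :=
        Finset.sum_le_sum_of_subset_of_nonneg Finset.subset_union_right fun t _ _ => h.nonneg t _
    _ = ∑ t ∈ S, φ t |f t| :=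
        (Finset.sum_subset Finset.subset_union_left fun t _ ht => hS t ht).symm
    _ ≤ 1 := hf

theorem orliczNorm_eq_gauge (f : C(K, ℝ)) : orliczNorm φ f = gauge (orliczBall φ) f := by
  rw [gauge_def', orliczNorm]
  congr 1
  ext ρ
  refine and_congr_right fun hρ => ?_
  have habs (t : K) : |f t| / ρ = |(ρ⁻¹ • f) t| := by
    rw [ContinuousMap.smul_apply, smul_eq_mul, abs_mul, abs_inv, abs_of_pos hρ, inv_mul_eq_div]
  simp only [habs, ENNReal.tsum_eq_iSup_sum, iSup_le_iff, orliczBall, mem_ofPred_eq, partialModular]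
  refine forall_congr' fun S => ?_
  rw [← ENNReal.ofReal_sum_of_nonneg fun t _ => h.nonneg t _, ENNReal.ofReal_le_one]

theorem convex_orliczBall : Convex ℝ (orliczBall φ) := by
  intro f hf g hg u v hu hv huv S
  refine ((h.convexOn_partialModular S).2 (mem_univ f) (mem_univ g) hu hv huv).trans ?_
  calc u * partialModular φ S f + v * partialModular φ S g ≤ u * 1 + v * 1 := by
        gcongr
        exacts [hf S, hg S]
    _ = 1 := by rw [mul_one, mul_one, huv]

theorem balanced_orliczBall : Balanced ℝ (orliczBall φ) := by
  rw [balanced_iff_smul_mem]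
  intro c hc f hf S
  refine le_trans (Finset.sum_le_sum fun t _ => h.monotone t ?_) (hf S)
  rw [ContinuousMap.smul_apply, smul_eq_mul, abs_mul]
  exact mul_le_of_le_one_left (abs_nonneg _) hc

theorem abs_lt_of_mem_orliczBall {f : C(K, ℝ)} (hf : f ∈ orliczBall φ) (t : K) : |f t| < b t := by
  by_contra! hlt
  have := hf {t}
  rw [partialModular, Finset.sum_singleton] at this
  exact (h.one_lt t _ hlt).not_ge this

variable [CompactSpace K]

theorem contDiff_partialModular (S : Finset K) : ContDiff ℝ ∞ (partialModular φ S) := by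
  unfold partialModular
  refine ContDiff.sum fun t _ => ?_
  have he : ContDiff ℝ ∞ fun f : C(K, ℝ) => f t :=
    (ContinuousMap.evalCLM ℝ t : StrongDual ℝ C(K, ℝ)).contDiff
  simp only [h.apply_abs]
  exact ((h.contDiff t).comp he).add ((h.contDiff t).comp he.neg)

theorem isClosed_orliczBall : IsClosed (orliczBall φ) := by
  simp only [orliczBall, ofPred_forall]
  exact isClosed_iInter fun S =>
    isClosed_le (h.contDiff_partialModular S).continuous continuous_const

theorem closedBall_subset_orliczBall : Metric.closedBall 0 α ⊆ orliczBall φ := by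
  intro f hf S
  rw [mem_closedBall_zero_iff] at hf
  refine le_of_eq_of_le (Finset.sum_eq_zero fun t _ => ?_) zero_le_one
  exact h.eq_zero_of_le ((f.norm_coe_le_norm t).trans hf) t

theorem orliczBall_subset_closedBall : orliczBall φ ⊆ Metric.closedBall 0 1 := by
  intro f hf
  rw [mem_closedBall_zero_iff, ContinuousMap.norm_le _ zero_le_one]
  exact fun t => (h.abs_lt_of_mem_orliczBall hf t).le.trans (h.le_one t)

theorem orliczBall_mem_nhds : orliczBall φ ∈ 𝓝 (0 : C(K, ℝ)) :=
  mem_of_superset (Metric.closedBall_mem_nhds 0 h.pos) h.closedBall_subset_orliczBall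

theorem absorbent_orliczBall : Absorbent ℝ (orliczBall φ) :=
  absorbent_nhds_zero h.orliczBall_mem_nhds

theorem norm_le_gauge (f : C(K, ℝ)) : ‖f‖ ≤ gauge (orliczBall φ) f := by
  have hle := le_gauge_of_subset_closedBall (E := C(K, ℝ)) (x := f) h.absorbent_orliczBall
    zero_le_one h.orliczBall_subset_closedBall
  rwa [div_one] at hle

theorem gauge_le (f : C(K, ℝ)) : gauge (orliczBall φ) f ≤ α⁻¹ * ‖f‖ := by
  rw [le_inv_mul_iff₀ h.pos]
  exact mul_gauge_le_norm (Metric.ball_subset_closedBall.trans h.closedBall_subset_orliczBall)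

/-- Near a point of the unit ball only finitely many coordinates contribute to the modular. By
compactness it suffices to find for each `t` a punctured neighbourhood on which `|g| < a`, with
room to spare; it exists as `|g t| < b t` and `b t` is at most the lower limit of `a` at `t`. -/
theorem exists_finset_eventually_eq_zero {g : C(K, ℝ)} (hg : g ∈ orliczBall φ) :
    ∃ S : Finset K, ∀ᶠ f in 𝓝 g, ∀ t ∉ S, φ t |f t| = 0 := by
  have hlt := h.abs_lt_of_mem_orliczBall hg
  let η : K → ℝ := fun t => (b t - |g t|) / 2
  have hη (t : K) : 0 < η t := half_pos (sub_pos.2 (hlt t))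
  have hU (t : K) : {s | s ≠ t → |g s| + η t / 2 < a s} ∈ 𝓝 t := by
    have h1 := h.eventually_lt t (|g t| + η t) (by have := hlt t; simp only [η]; linarith)
    rw [eventually_nhdsWithin_iff] at h1
    have h2 : ∀ᶠ s in 𝓝 t, |g s| < |g t| + η t / 2 :=
      (g.continuous.abs.tendsto t).eventually (gt_mem_nhds (by linarith [hη t]))
    filter_upwards [h1, h2] with s hs1 hs2 hst
    linarith [hs1 hst]
  obtain ⟨S, hS⟩ := CompactSpace.elim_nhds_subcover _ hU
  refine ⟨S, ?_⟩
  have hev : ∀ᶠ f in 𝓝 g, ∀ t ∈ S, dist f g < η t / 2 := by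
    rw [Filter.eventually_all_finset]
    exact fun t _ => Metric.ball_mem_nhds g (half_pos (hη t))
  filter_upwards [hev] with f hf s hs
  obtain ⟨t, htS, hst⟩ : ∃ t ∈ S, s ∈ {s | s ≠ t → |g s| + η t / 2 < a s} := by
    simpa using (hS ▸ mem_univ s : s ∈ ⋃ x ∈ S, {s | s ≠ x → |g s| + η x / 2 < a s})
  refine h.eq_zero s _ ?_
  have h1 : |f s - g s| < η t / 2 := (ContinuousMap.dist_apply_le_dist s).trans_lt (hf t htS)
  have h2 := abs_sub_abs_le_abs_sub (f s) (g s)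
  have h3 := hst (fun e => hs (e ▸ htS))
  linarith

theorem gauge_eq_one_of_partialModular_eq_one {S : Finset K} {f : C(K, ℝ)}
    (hS : ∀ t ∉ S, φ t |f t| = 0) (hf : partialModular φ S f = 1) :
    gauge (orliczBall φ) f = 1 := by
  refine le_antisymm (gauge_le_one_of_mem (h.mem_orliczBall_of_le_one hS hf.le)) ?_
  by_contra! hlt
  obtain ⟨c, hc0, hc1, k, hk, rfl⟩ := exists_lt_of_gauge_lt h.absorbent_orliczBall hlt
  have hc := (h.convexOn_partialModular S).2 (mem_univ k) (mem_univ 0) hc0.le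
    (sub_nonneg.2 hc1.le) (add_sub_cancel _ _)
  rw [smul_zero, add_zero, h.partialModular_zero, smul_zero, add_zero, smul_eq_mul] at hc
  have hle := mul_le_mul_of_nonneg_left (hk S) hc0.le
  have heq : partialModular φ S (c • k) = 1 := hf
  linarith

theorem exists_partialModular_eq_one {g : C(K, ℝ)} (hg : gauge (orliczBall φ) g = 1) :
    ∃ S : Finset K, (∀ᶠ f in 𝓝 g, ∀ t ∉ S, φ t |f t| = 0) ∧ partialModular φ S g = 1 := by
  have hmem : g ∈ orliczBall φ := by
    have := (gauge_le_one_iff_mem_closure h.convex_orliczBall h.orliczBall_mem_nhds).1 hg.le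
    rwa [h.isClosed_orliczBall.closure_eq] at this
  obtain ⟨S, hS⟩ := h.exists_finset_eventually_eq_zero hmem
  refine ⟨S, hS, le_antisymm (hmem S) ?_⟩
  by_contra! hlt
  -- otherwise a neighbourhood of `g` lies in the unit ball
  have hint : g ∈ interior (orliczBall φ) := by
    rw [mem_interior_iff_mem_nhds]
    filter_upwards [hS, (h.contDiff_partialModular S).continuous.continuousAt.eventually
      (gt_mem_nhds hlt)] with f hf1 hf2
    exact h.mem_orliczBall_of_le_one hf1 hf2.le
  exact (interior_subset_gauge_lt_one _ hint).ne hg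

/-- The generalized Orlicz norm as a seminorm on `C(K)`. -/
def seminorm : Seminorm ℝ C(K, ℝ) :=
  gaugeSeminorm h.balanced_orliczBall h.convex_orliczBall h.absorbent_orliczBall

theorem contDiffOn_seminorm : ContDiffOn ℝ ∞ h.seminorm {0}ᶜ := by
  intro f hf
  have hpos : 0 < h.seminorm f := (norm_pos_iff.2 hf).trans_le (h.norm_le_gauge f)
  refine (Seminorm.contDiffAt_of_smul _ (inv_pos.2 hpos) ?_).contDiffWithinAt
  have hone : h.seminorm ((h.seminorm f)⁻¹ • f) = 1 := by
    rw [map_smul_eq_mul, Real.norm_of_nonneg (inv_nonneg.2 hpos.le), inv_mul_cancel₀ hpos.ne']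
  obtain ⟨S, hS, hg⟩ := h.exists_partialModular_eq_one hone
  exact Seminorm.contDiffAt_of_convexOn _ (h.contDiff_partialModular S)
    (h.convexOn_partialModular S) (h.partialModular_zero S) hg
    (hS.mono fun k hk hk1 => h.gauge_eq_one_of_partialModular_eq_one hk hk1)

end IsSmoothOrliczFamily

end Orlicz

/-! ### Smooth renorming of `C(K)` -/

theorem theorem2 {K : Type*} [TopologicalSpace K] [CompactSpace K] [T2Space K]
    (hK : ∃ p : Seminorm ℝ C(K, ℝ),
      IsEquivalentNorm p ∧ IsLocallyUniformlyRotund (dualNorm p)) :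
    ∃ D : ℕ → Set K, IsDiscretePartition D ∧
      ∀ ε : ℝ, 0 < ε →
        ∃ (r : ℕ → ℝ) (φ : K → ℝ → ℝ) (N : Seminorm ℝ C(K, ℝ)),
          -- the weights
          (∀ i, 0 < r i ∧ r i < 1) ∧ 0 < ∏' i, r i ∧ (∏' i, r i)⁻¹ ≤ 1 + ε ∧
          -- the infinitely differentiable Orlicz functions
          (∀ t, IsOrliczFunction (φ t) ∧ ContDiffOn ℝ ∞ (φ t) (Ici 0) ∧
            (∀ x, 0 ≤ x → x ≤ closureProd D r t → φ t x = 0) ∧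
            (∀ x, derivedProd D r t ≤ x → 1 < φ t x)) ∧
          -- the norm
          (∀ f : C(K, ℝ), N f = orliczNorm φ f) ∧
          IsEquivalentNorm N ∧
          ContDiffOn ℝ ∞ N {0}ᶜ ∧
          (∀ f : C(K, ℝ), ‖f‖ ≤ N f ∧ N f ≤ (∏' i, r i)⁻¹ * ‖f‖) := by
  obtain ⟨p, hp, hq⟩ := hK
  obtain ⟨D, hD⟩ := exists_isDiscretePartition hp hq
  refine ⟨D, hD, fun ε hε => ?_⟩
  have hlog : 0 < Real.log (1 + ε) := Real.log_pos (by linarith)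
  -- weights of total mass `log (1 + ε)`
  obtain ⟨c, hc0, hc⟩ : ∃ c : ℕ → ℝ, (∀ i, 0 < c i) ∧ HasSum c (Real.log (1 + ε)) :=
    ⟨_, fun i => by positivity, hasSum_geometric_two' (Real.log (1 + ε))⟩
  have hprod : ∏' i, Real.exp (-c i) = (1 + ε)⁻¹ := by
    rw [← Real.rexp_tsum_eq_tprod (fun _ => Real.exp_pos _)
      (by simpa only [Real.log_exp] using hc.summable.neg)]
    simp only [Real.log_exp, tsum_neg, hc.tsum_eq]
    rw [Real.exp_neg, Real.exp_log (by linarith)]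
  have hα : (1 + ε)⁻¹ = Real.exp (-∑' i, c i) := by
    rw [hc.tsum_eq, Real.exp_neg, Real.exp_log (by linarith)]
  choose φ hφ using fun t => exists_smooth_convex_between
    (closureProd_lt_derivedProd hD hc.summable hc0 t)
  have h : IsSmoothOrliczFamily (1 + ε)⁻¹ (closureProd D fun i => Real.exp (-c i))
      (derivedProd D fun i => Real.exp (-c i)) φ :=
    { contDiff := fun t => (hφ t).1
      convexOn := fun t => (hφ t).2.1
      monotone := fun t => (hφ t).2.2.1
      eq_zero := fun t => (hφ t).2.2.2.2.1
      one_lt := fun t => (hφ t).2.2.2.2.2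
      pos := by positivity
      le := fun t => hα ▸ exp_neg_tsum_le_closureProd hc.summable hc0 D t
      le_one := derivedProd_exp_neg_le_one hc.summable hc0 D
      eventually_lt := fun t y hy => eventually_lt_closureProd hc.summable hc0 hy }
  have hbounds (f : C(K, ℝ)) : ‖f‖ ≤ h.seminorm f ∧ h.seminorm f ≤ (1 + ε) * ‖f‖ :=
    ⟨h.norm_le_gauge f, (h.gauge_le f).trans_eq (by rw [inv_inv])⟩
  refine ⟨fun i => Real.exp (-c i), φ, h.seminorm, fun i => ⟨Real.exp_pos _, ?_⟩, ?_, ?_,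
    fun t => ⟨⟨?_, fun x _ => h.nonneg t x, h.eq_zero_of_le h.pos.le t, (hφ t).2.2.2.1⟩,
      (h.contDiff t).contDiffOn, fun x _ => h.eq_zero t x, h.one_lt t⟩,
    fun f => (h.orliczNorm_eq_gauge f).symm, ?_, h.contDiffOn_seminorm, ?_⟩
  · exact Real.exp_lt_one_iff.2 (neg_lt_zero.2 (hc0 i))
  · rw [hprod]; positivity
  · rw [hprod, inv_inv]
  · exact (h.convexOn t).subset (subset_univ _) (convex_Ici 0)
  · exact ⟨1, 1 + ε, one_pos, by linarith, fun f => by simpa using hbounds f⟩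
  · simpa only [hprod, inv_inv] using hbounds

end
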